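/- Let $G=(V,E)$ be a finite simple undirected graph and let $k\ge 1$ be an integer. A *random $k$-out subgraph* of $G$ is the random graph $G'=(V,S)$ obtained as follows: each vertex $v\in V$, independently of the others, chooses a uniformly random set of exactly $\min\{k,\deg_G(v)\}$ of the edges of $G$ incident to $v$, and $S$ is the set of all edges chosen by at least one of their endpoints. An edge of $G$ is called *inter-component* (with respect to $G'$) if its endpoints lie in different connected components of $G'$. Corollary. There exist absolute constants $c>0$ and $b>0$ such that the following holds. Let $G$ be an arbitrary simple undirected graph on $n$ vertices, let $k\ge 1$ be an integer with $k\ge c\log n$, and let $G'$ be a random $k$-out subgraph of $G$. Then, for every real number $\ell\ge 1$, $$\Pr\Bigl[\,\#\{\text{inter-component edges of } G \text{ with respect to } G'\} > \ell\cdot \frac{bn}{k}\Bigr]\;\le\; 2^{-\ell}.$$ -/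

import Mathlib

namespace KOut

open Classical in
/-- The admissible choices of the vertex `v`: the sets of exactly `min k (deg v)` edges of `G`
incident to `v`. -/
noncomputable def choices {V : Type*} [Fintype V] (G : SimpleGraph V) (k : ℕ) (v : V) :
    Finset (Finset (Sym2 V)) :=
  (G.incidenceFinset v).powersetCard (min k (G.degree v))

theorem choices_nonempty {V : Type*} [Fintype V] (G : SimpleGraph V) (k : ℕ) (v : V) :
    (choices G k v).Nonempty := by
  classical
  unfold choices
  rw [Finset.powersetCard_nonempty, SimpleGraph.card_incidenceFinset_eq_degree]
  exact min_le_right _ _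

open Classical in
theorem piChoices_nonempty {V : Type*} [Fintype V] (G : SimpleGraph V) (k : ℕ) :
    (Fintype.piFinset (choices G k)).Nonempty :=
  Fintype.piFinset_nonempty.2 (choices_nonempty G k)

open Classical in
/-- The joint law of the choices of all vertices: the uniform distribution on the product of the
sets of admissible choices. Equivalently (see `choiceLaw_apply`) the vertices choose
independently, each of them uniformly among its admissible choices. -/
noncomputable def choiceLaw {V : Type*} [Fintype V] (G : SimpleGraph V) (k : ℕ) :
    PMF (V → Finset (Sym2 V)) :=
  PMF.uniformOfFinset (Fintype.piFinset (choices G k)) (piChoices_nonempty G k)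

/-- The joint law is the product of the uniform laws of the single vertices. -/
theorem choiceLaw_apply {V : Type*} [Fintype V] (G : SimpleGraph V) (k : ℕ)
    (S : V → Finset (Sym2 V)) :
    choiceLaw G k S =
      ∏ v, PMF.uniformOfFinset (choices G k v) (choices_nonempty G k v) (S v) := by
  classical
  unfold choiceLaw
  simp only [PMF.uniformOfFinset_apply, Fintype.mem_piFinset]
  by_cases h : ∀ v, S v ∈ choices G k v
  · simp only [h, implies_true, if_true, Fintype.card_piFinset, Nat.cast_prod]
    exact ENNReal.prod_inv_distrib fun i _ j _ _ => Or.inr (ENNReal.natCast_ne_top _)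
  · rw [if_neg h]
    push Not at h
    obtain ⟨v, hv⟩ := h
    exact (Finset.prod_eq_zero (Finset.mem_univ v) (by simp [hv])).symm

/-- The spanning subgraph whose edges are those chosen by at least one vertex. -/
def chosenSubgraph {V : Type*} (S : V → Finset (Sym2 V)) : SimpleGraph V :=
  SimpleGraph.fromEdgeSet {e | ∃ v, e ∈ S v}

/-- The law of a random `k`-out subgraph of `G`. -/
noncomputable def randomSubgraph {V : Type*} [Fintype V] (G : SimpleGraph V) (k : ℕ) :
    PMF (SimpleGraph V) :=
  (choiceLaw G k).map chosenSubgraph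

/-- The edges of `G` that connect different connected components of `G'`. -/
def interComponentEdges {V : Type*} (G G' : SimpleGraph V) : Set (Sym2 V) :=
  {e | e ∈ G.edgeSet ∧ ∃ u v, e = s(u, v) ∧
    G'.connectedComponentMk u ≠ G'.connectedComponentMk v}

end KOut

/-!
The proof reveals the random choices one edge at a time and follows a potential. For a subgraph
`H` of `G`, the potential is the sum over the connected components of `H` of the largest
`G`-degree in the component. If `s(u, w)` joins two components and `deg u ≤ deg w`, then adding
this edge lowers the potential by at least `deg u` (`degree_add_potential_le`), and a uniform
pick of `u` finds it with probability `1 / deg u`. Hence every inter-component edge present when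
its lower endpoint picks contributes at least `1` to the expected decrease of the potential,
independently of its degree (`avg_exp_excess_le`). Consequently, when every vertex picks one
edge, the expected drop of the potential is at least the expected number of edges that are still
inter-component afterwards; `sweep_exp_excess_add_crossing_le` is the exponential-moment form.

This is used in two ways. Since `G` is simple, a vertex of degree `d` in a component `C` has more
than `d - |C|` neighbours outside `C`, so that the potential is at most `n` plus twice the number of
inter-component edges (`potential_le_card_add_crossing`). Therefore the excess of the potential
over `n` contracts by a constant factor per sweep, and `⌊k / 2⌋ ≥ 5 log n - 1 / 2` sweeps bring the
potential from at most `n ^ 2` down to `O(n)` (`iterate_sweep_exp_excess_le`). In the remaining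
`k / 2` sweeps every surviving inter-component edge is paid for in each sweep out of this
potential, which leaves `O(n / k)` of them (`iterate_sweep_exp_crossing_le`). As all estimates hold
for exponential moments, Markov's inequality gives the tail bound.

The sweeps consist of independent picks with repetition, whereas the choice of a vertex is a uniform
set of `min k (deg v)` distinct edges. Replacing the former by the latter only decreases the
expectation of a decreasing functional of the chosen graph (`sweep_le_iterate`).
-/

namespace KOut

section

open Finset SimpleGraph
open scoped BigOperators

/-! ### Comparing uniform subsets with repeated uniform picks -/

/-- Double counting of the pairs consisting of a `(j + 1)`-subset of `E` and one of its elements: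
choose the element last, or choose it out of the subset. -/
theorem sum_powersetCard_sum_sdiff_insert {α : Type*} [DecidableEq α] (E : Finset α) (j : ℕ)
    (f : Finset α → ℝ) :
    ∑ S ∈ E.powersetCard j, ∑ e ∈ E \ S, f (insert e S) =
      (j + 1) * ∑ T ∈ E.powersetCard (j + 1), f T := by
  have h : ∀ T ∈ E.powersetCard (j + 1), ∑ _e ∈ T, f T = (j + 1) * f T := by
    intro T hT
    rw [sum_const, (mem_powersetCard.1 hT).2, nsmul_eq_mul]
    push_cast
    rfl
  rw [mul_sum, ← sum_congr rfl h, sum_sigma', sum_sigma']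
  refine sum_bij' (fun p _ => ⟨insert p.2 p.1, p.2⟩) (fun p _ => ⟨p.1.erase p.2, p.2⟩)
    ?_ ?_ ?_ ?_ ?_
  · rintro ⟨S, e⟩ h
    simp only [mem_sigma, mem_powersetCard, mem_sdiff] at h ⊢
    obtain ⟨⟨hS, hc⟩, he, heS⟩ := h
    exact ⟨⟨insert_subset he hS, by rw [card_insert_of_notMem heS, hc]⟩, mem_insert_self _ _⟩
  · rintro ⟨T, e⟩ h
    simp only [mem_sigma, mem_powersetCard, mem_sdiff] at h ⊢
    obtain ⟨⟨hT, hc⟩, he⟩ := h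
    exact ⟨⟨(erase_subset _ _).trans hT, by rw [card_erase_of_mem he, hc]; rfl⟩, hT he,
      notMem_erase _ _⟩
  · rintro ⟨S, e⟩ h
    simp only [mem_sigma, mem_powersetCard, mem_sdiff] at h
    simp [erase_insert h.2.2]
  · rintro ⟨T, e⟩ h
    simp only [mem_sigma, mem_powersetCard] at h
    simp [insert_erase h.2]
  · rintro ⟨S, e⟩ _
    rfl

/-- A uniform `(j + 1)`-subset of `E` is at least as good as a uniform `j`-subset together with an
independent uniform element of `E`, which may repeat an element already chosen. -/
theorem expect_powersetCard_succ_le {α : Type*} [DecidableEq α] (E : Finset α) (j : ℕ)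
    (hj : j < #E) (f : Finset α → ℝ) (hf : Antitone f) :
    𝔼 T ∈ E.powersetCard (j + 1), f T ≤
      𝔼 S ∈ E.powersetCard j, 𝔼 e ∈ E, f (insert e S) := by
  have hj' : (0 : ℝ) < #E - j := by rw [sub_pos]; exact_mod_cast hj
  have hE : (0 : ℝ) < #E := by exact_mod_cast (Nat.zero_le j).trans_lt hj
  have hC : (0 : ℝ) < (#E).choose j := by exact_mod_cast Nat.choose_pos hj.le
  have hC' : (0 : ℝ) < (#E).choose (j + 1) := by exact_mod_cast Nat.choose_pos hj
  have hCC : ((#E).choose (j + 1) : ℝ) * (j + 1) = (#E).choose j * (#E - j) := by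
    have := Nat.choose_succ_right_eq (#E) j
    rw [← Nat.cast_sub hj.le]
    exact_mod_cast this
  -- The repeated picks are accounted for by antitonicity: `f S` is at least the average of
  -- `f (insert e S)` over the elements `e` outside `S`.
  have key : ∀ S ∈ E.powersetCard j,
      (∑ e ∈ E \ S, f (insert e S)) / (#E - j) ≤ 𝔼 e ∈ E, f (insert e S) := by
    intro S hS
    obtain ⟨hSE, hSc⟩ := mem_powersetCard.1 hS
    have h1 : ∑ e ∈ S, f (insert e S) = j * f S := by
      rw [sum_congr rfl fun e he => by rw [insert_eq_of_mem he], sum_const, hSc, nsmul_eq_mul]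
    have h2 : ∑ e ∈ E \ S, f (insert e S) ≤ (#E - j) * f S := by
      have : ∑ e ∈ E \ S, f (insert e S) ≤ ∑ _e ∈ E \ S, f S :=
        sum_le_sum fun e _ => hf (subset_insert e S)
      rwa [sum_const, card_sdiff_of_subset hSE, hSc, nsmul_eq_mul, Nat.cast_sub hj.le] at this
    rw [expect_eq_sum_div_card, ← sum_sdiff hSE, h1, div_le_div_iff₀ hj' hE]
    nlinarith [mul_le_mul_of_nonneg_left h2 (Nat.cast_nonneg (α := ℝ) j)]
  refine le_trans (le_of_eq ?_) (expect_le_expect key)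
  rw [← expect_div, expect_eq_sum_div_card, expect_eq_sum_div_card,
    sum_powersetCard_sum_sdiff_insert, card_powersetCard, card_powersetCard, div_div, ← hCC,
    div_eq_div_iff hC'.ne' (by positivity)]
  ring

/-- Resampling one coordinate of a uniform element of a product does not change its law. -/
theorem expect_piFinset_update {ι α : Type*} [Fintype ι] [DecidableEq ι] (t : ι → Finset α)
    (ht : ∀ i, (t i).Nonempty) (a : ι) (F : (ι → α) → ℝ) :
    𝔼 S ∈ Fintype.piFinset t, 𝔼 T ∈ t a, F (Function.update S a T) =
      𝔼 S ∈ Fintype.piFinset t, F S := by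
  have h : ∀ S ∈ Fintype.piFinset t, 𝔼 _T ∈ t a, F S = F S := fun S _ => expect_const (ht a) _
  rw [← expect_congr rfl h, ← expect_product' _ _ fun S T => F (Function.update S a T),
    ← expect_product' _ _ fun S _ => F S]
  refine expect_nbij' (fun p => (Function.update p.1 a p.2, p.1 a))
    (fun p => (Function.update p.1 a p.2, p.1 a)) ?_ ?_ ?_ ?_ ?_
  · rintro ⟨S, T⟩ h
    simp only [mem_product, Fintype.mem_piFinset] at h ⊢
    refine ⟨fun i => ?_, h.1 a⟩
    rcases eq_or_ne i a with rfl | hi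
    · simpa using h.2
    · simpa [hi] using h.1 i
  · rintro ⟨S, T⟩ h
    simp only [mem_product, Fintype.mem_piFinset] at h ⊢
    refine ⟨fun i => ?_, h.1 a⟩
    rcases eq_or_ne i a with rfl | hi
    · simpa using h.2
    · simpa [hi] using h.1 i
  · rintro ⟨S, T⟩ _
    simp
  · rintro ⟨S, T⟩ _
    simp
  · rintro ⟨S, T⟩ _
    rfl

/-! ### Averaging over added edges -/

variable {V : Type*}

/-- The expected value of `f` after a uniformly random member of `t` has been added to the edges
of `H`, as a function of `H`. -/
noncomputable def avg (t : Finset (Finset (Sym2 V))) (f : SimpleGraph V → ℝ)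
    (H : SimpleGraph V) : ℝ :=
  𝔼 S ∈ t, f (H ⊔ fromEdgeSet (S : Set (Sym2 V)))

theorem avg_mono (t : Finset (Finset (Sym2 V))) {f g : SimpleGraph V → ℝ} (h : f ≤ g) :
    avg t f ≤ avg t g :=
  fun _ => expect_le_expect fun _ _ => h _

theorem avg_antitone (t : Finset (Finset (Sym2 V))) {f : SimpleGraph V → ℝ} (hf : Antitone f) :
    Antitone (avg t f) :=
  fun _ _ h => expect_le_expect fun _ _ => hf (sup_le_sup_right h _)

theorem avg_comm (t t' : Finset (Finset (Sym2 V))) (f : SimpleGraph V → ℝ) :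
    avg t (avg t' f) = avg t' (avg t f) := by
  ext H
  unfold avg
  rw [expect_comm]
  simp only [sup_right_comm]

theorem avg_nonneg (t : Finset (Finset (Sym2 V))) {f : SimpleGraph V → ℝ} (hf : 0 ≤ f) :
    0 ≤ avg t f :=
  fun _ => expect_nonneg fun _ _ => hf _

/-- An antitone factor may be frozen at its initial value. -/
theorem avg_mul_le (t : Finset (Finset (Sym2 V))) {f h : SimpleGraph V → ℝ} (hf : 0 ≤ f)
    (hh : Antitone h) : avg t (h * f) ≤ h * avg t f := by
  intro H
  simp only [Pi.mul_apply, avg]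
  rw [mul_expect]
  exact expect_le_expect fun S _ => mul_le_mul_of_nonneg_right (hh le_sup_left) (hf _)

variable [Fintype V]

/-- The expected value of `f` after each vertex of the list `L`, independently, has added a uniform
set of `min j (deg v)` incident edges. -/
noncomputable def sweep (G : SimpleGraph V) (j : ℕ) (L : List V) (f : SimpleGraph V → ℝ) :
    SimpleGraph V → ℝ :=
  L.foldr (fun v g => avg (choices G j v) g) f

@[simp]
theorem sweep_nil (G : SimpleGraph V) (j : ℕ) (f : SimpleGraph V → ℝ) : sweep G j [] f = f := rfl

@[simp]
theorem sweep_cons (G : SimpleGraph V) (j : ℕ) (v : V) (L : List V) (f : SimpleGraph V → ℝ) :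
    sweep G j (v :: L) f = avg (choices G j v) (sweep G j L f) := rfl

theorem sweep_mono (G : SimpleGraph V) (j : ℕ) (L : List V) {f g : SimpleGraph V → ℝ}
    (h : f ≤ g) : sweep G j L f ≤ sweep G j L g := by
  induction L with
  | nil => exact h
  | cons v L ih => exact avg_mono _ ih

theorem sweep_antitone (G : SimpleGraph V) (j : ℕ) (L : List V) {f : SimpleGraph V → ℝ}
    (hf : Antitone f) : Antitone (sweep G j L f) := by
  induction L with
  | nil => exact hf
  | cons v L ih => exact avg_antitone _ ih

theorem sweep_nonneg (G : SimpleGraph V) (j : ℕ) (L : List V) {f : SimpleGraph V → ℝ}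
    (hf : 0 ≤ f) : 0 ≤ sweep G j L f := by
  induction L with
  | nil => exact hf
  | cons v L ih => exact avg_nonneg _ ih

theorem sweep_mul_le (G : SimpleGraph V) (j : ℕ) (L : List V) {f h : SimpleGraph V → ℝ}
    (hf : 0 ≤ f) (hh : Antitone h) : sweep G j L (h * f) ≤ h * sweep G j L f := by
  induction L with
  | nil => exact le_rfl
  | cons v L ih => exact (avg_mono _ ih).trans (avg_mul_le _ (sweep_nonneg G j L hf) hh)

theorem avg_sweep_comm (G : SimpleGraph V) (j : ℕ) (L : List V) (t : Finset (Finset (Sym2 V)))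
    (f : SimpleGraph V → ℝ) : avg t (sweep G j L f) = sweep G j L (avg t f) := by
  induction L with
  | nil => rfl
  | cons v L ih => rw [sweep_cons, avg_comm, ih, sweep_cons]

theorem choices_zero (G : SimpleGraph V) (v : V) : choices G 0 v = {∅} := by
  simp [choices]

theorem sweep_zero (G : SimpleGraph V) (L : List V) (f : SimpleGraph V → ℝ) :
    sweep G 0 L f = f := by
  induction L with
  | nil => rfl
  | cons v L ih =>
    ext H
    simp [ih, avg, choices_zero]

/-- For a decreasing functional, choosing one more distinct edge at a vertex is at least as good as
an additional independent pick with repetition. -/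
theorem avg_choices_succ_le (G : SimpleGraph V) (j : ℕ) (v : V) {f : SimpleGraph V → ℝ}
    (hf : Antitone f) :
    avg (choices G (j + 1) v) f ≤ avg (choices G j v) (avg (choices G 1 v) f) := by
  classical
  intro H
  have hc : #(G.incidenceFinset v) = G.degree v := G.card_incidenceFinset_eq_degree v
  rcases lt_or_ge j (G.degree v) with hj | hj
  · have h := expect_powersetCard_succ_le (G.incidenceFinset v) j (by rw [hc]; exact hj)
      (fun S => f (H ⊔ fromEdgeSet (S : Set (Sym2 V)))) fun S T hST =>
        hf (sup_le_sup_left (fromEdgeSet_mono (by exact_mod_cast hST)) _)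
    have e1 : min (j + 1) (G.degree v) = j + 1 := min_eq_left hj
    have e2 : min j (G.degree v) = j := min_eq_left hj.le
    have e3 : min 1 (G.degree v) = 1 := min_eq_left (by omega)
    unfold avg choices
    simp only [e1, e2, e3]
    convert h using 4 with S hS
    rw [powersetCard_one, expect_eq_sum_div_card, expect_eq_sum_div_card, card_map, sum_map]
    congr 1
    refine sum_congr rfl fun e _ => ?_
    congr 1
    rw [sup_assoc, ← fromEdgeSet_union]
    rw [coe_insert, Set.insert_eq, Set.union_comm]
    simp
  · -- All edges are already chosen, and the additional pick repeats one of them.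
    have e1 : choices G (j + 1) v = {G.incidenceFinset v} := by
      unfold choices
      rw [min_eq_right (by omega), ← hc, powersetCard_self]
    have e2 : choices G j v = {G.incidenceFinset v} := by
      unfold choices
      rw [min_eq_right hj, ← hc, powersetCard_self]
    rw [e1, e2]
    simp only [avg, expect_singleton]
    refine le_expect (choices_nonempty G 1 v) fun S hS => hf ?_
    rw [sup_assoc, ← fromEdgeSet_union]
    refine sup_le_sup_left (fromEdgeSet_mono (Set.union_subset subset_rfl ?_)) _
    exact_mod_cast (mem_powersetCard.1 hS).1

theorem sweep_succ_le (G : SimpleGraph V) (j : ℕ) (L : List V) {f : SimpleGraph V → ℝ}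
    (hf : Antitone f) : sweep G (j + 1) L f ≤ sweep G j L (sweep G 1 L f) := by
  induction L with
  | nil => exact le_rfl
  | cons v L ih =>
    simp only [sweep_cons]
    calc avg (choices G (j + 1) v) (sweep G (j + 1) L f)
        ≤ avg (choices G j v) (avg (choices G 1 v) (sweep G (j + 1) L f)) :=
          avg_choices_succ_le G j v (sweep_antitone G _ L hf)
      _ ≤ avg (choices G j v) (avg (choices G 1 v) (sweep G j L (sweep G 1 L f))) :=
          avg_mono _ (avg_mono _ ih)
      _ = _ := by rw [avg_sweep_comm G j L]

/-- For a decreasing functional, `k` sweeps with a single pick per vertex are an upper bound for a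
`k`-out choice. -/
theorem sweep_le_iterate (G : SimpleGraph V) (L : List V) (k : ℕ) {f : SimpleGraph V → ℝ}
    (hf : Antitone f) : sweep G k L f ≤ (sweep G 1 L)^[k] f := by
  induction k generalizing f with
  | zero => rw [sweep_zero]; exact le_rfl
  | succ k ih =>
    rw [Function.iterate_succ_apply]
    exact (sweep_succ_le G k L hf).trans (ih (sweep_antitone G 1 L hf))

open Classical in
/-- Averaging over the independent choices of the vertices in `L` can be done one vertex at a
time. -/
theorem expect_choices_eq_sweep (G : SimpleGraph V) (k : ℕ) (L : List V) (hL : L.Nodup)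
    (f : SimpleGraph V → ℝ) (H : SimpleGraph V) :
    𝔼 S ∈ Fintype.piFinset (choices G k), f (H ⊔ fromEdgeSet {e | ∃ v ∈ L, e ∈ S v}) =
      sweep G k L f H := by
  induction L generalizing H with
  | nil => simp [expect_const (piChoices_nonempty G k)]
  | cons u L ih =>
    rw [List.nodup_cons] at hL
    rw [← expect_piFinset_update _ (choices_nonempty G k) u, expect_comm, sweep_cons, avg]
    refine expect_congr rfl fun T _ => ?_
    rw [← ih hL.2]
    refine expect_congr rfl fun S _ => ?_
    rw [sup_assoc, ← fromEdgeSet_union]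
    congr 3
    ext e
    simp only [List.mem_cons, exists_eq_or_imp, Function.update_self, Set.mem_ofPred_eq,
      Set.mem_union, mem_coe]
    refine or_congr Iff.rfl (exists_congr fun v => and_congr_right fun hv => ?_)
    rw [Function.update_of_ne (ne_of_mem_of_not_mem hv hL.1)]


/-! ### The degree potential and the crossing edges -/

open Classical in
/-- The sets of vertices that meet every connected component of `H` at most once. -/
noncomputable def transversals (H : SimpleGraph V) : Finset (Finset V) :=
  univ.filter fun I => ∀ x ∈ I, ∀ y ∈ I, H.Reachable x y → x = y

open Classical in
/-- The sum over the connected components of `H` of the largest `G`-degree in the component,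
written as the largest total degree of a set of vertices in distinct components. -/
noncomputable def potential (G H : SimpleGraph V) : ℕ :=
  (transversals H).sup fun I => ∑ v ∈ I, G.degree v

open Classical in
/-- The neighbours `w` of `u` in `G` that lie in another connected component of `H` and have at
least the degree of `u`. -/
noncomputable def crossingNeighbors (G H : SimpleGraph V) (u : V) : Finset V :=
  univ.filter fun w => G.Adj u w ∧ ¬ H.Reachable u w ∧ G.degree u ≤ G.degree w

/-- The number of inter-component edges, each counted at its endpoint of smaller degree; an edge
whose endpoints have the same degree is counted twice. -/
noncomputable def crossing (G H : SimpleGraph V) : ℕ := ∑ u, #(crossingNeighbors G H u)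

theorem crossingNeighbors_antitone (G : SimpleGraph V) (u : V) :
    Antitone fun H => #(crossingNeighbors G H u) := by
  classical
  intro H H' h
  refine card_le_card fun w hw => ?_
  simp only [crossingNeighbors, mem_filter, mem_univ, true_and] at hw ⊢
  exact ⟨hw.1, fun hr => hw.2.1 (hr.mono h), hw.2.2⟩

theorem crossing_antitone (G : SimpleGraph V) : Antitone (crossing G) :=
  fun _ _ h => sum_le_sum fun u _ => crossingNeighbors_antitone G u h

open Classical in
theorem sum_degree_le_potential (G H : SimpleGraph V) {I : Finset V} (hI : I ∈ transversals H) :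
    ∑ v ∈ I, G.degree v ≤ potential G H := by
  unfold potential
  exact le_sup (f := fun I : Finset V => ∑ v ∈ I, G.degree v) hI

open Classical in
theorem exists_sum_degree_eq_potential (G H : SimpleGraph V) :
    ∃ I ∈ transversals H, potential G H = ∑ v ∈ I, G.degree v := by
  unfold potential
  exact exists_mem_eq_sup _ ⟨∅, by simp [transversals]⟩ _

theorem potential_antitone (G : SimpleGraph V) : Antitone (potential G) := by
  classical
  intro H H' h
  obtain ⟨I, hI, hP⟩ := exists_sum_degree_eq_potential G H'
  rw [hP]
  refine sum_degree_le_potential G H ?_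
  simp only [transversals, mem_filter, mem_univ, true_and] at hI ⊢
  exact fun x hx y hy hr => hI x hx y hy (hr.mono h)

open Classical in
/-- Merging the components of `u` and `w` lowers the potential by at least the smaller of the two
degrees. -/
theorem degree_add_potential_le (G : SimpleGraph V) {H H' : SimpleGraph V} (h : H ≤ H') {u w : V}
    (huw : ¬ H.Reachable u w) (huw' : H'.Reachable u w) (hd : G.degree u ≤ G.degree w) :
    G.degree u + potential G H' ≤ potential G H := by
  obtain ⟨I, hI, hP⟩ := exists_sum_degree_eq_potential G H'
  simp only [transversals, mem_filter, mem_univ, true_and] at hI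
  -- An `H'`-transversal misses the `H`-component of `u` or that of `w`, hence can be enlarged.
  obtain ⟨a, ha, haI⟩ : ∃ a, G.degree u ≤ G.degree a ∧ ∀ x ∈ I, ¬ H.Reachable x a := by
    by_contra! hcon
    obtain ⟨x, hx, hxu⟩ := hcon u le_rfl
    obtain ⟨y, hy, hyw⟩ := hcon w hd
    obtain rfl := hI x hx y hy (((hxu.mono h).trans huw').trans (hyw.mono h).symm)
    exact huw (hxu.symm.trans hyw)
  have haI' : a ∉ I := fun h' => haI a h' (Reachable.refl a)
  rw [hP]
  refine le_trans ?_ (sum_degree_le_potential G H (I := insert a I) ?_)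
  · rw [sum_insert haI']
    omega
  · simp only [transversals, mem_filter, mem_univ, true_and]
    intro x hx y hy hr
    rcases mem_insert.1 hx with rfl | hx' <;> rcases mem_insert.1 hy with rfl | hy'
    · rfl
    · exact absurd hr.symm (haI y hy')
    · exact absurd hr (haI x hx')
    · exact hI x hx' y hy' (hr.mono h)

theorem potential_le (G H : SimpleGraph V) :
    potential G H ≤ Fintype.card V * Fintype.card V := by
  classical
  obtain ⟨I, -, hP⟩ := exists_sum_degree_eq_potential G H
  rw [hP]
  refine (sum_le_card_nsmul _ _ (Fintype.card V) fun v _ => ?_).trans ?_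
  · exact (G.degree_lt_card_verts v).le
  · exact Nat.mul_le_mul_right _ (card_le_univ I)

open Classical in
/-- A vertex `v` has at least `deg v - |C|` neighbours outside its component `C`. Taking vertices
of largest degree in their components, the total size of the subtracted components is at most the
number of vertices. -/
theorem potential_le_card_add_crossing (G H : SimpleGraph V) :
    potential G H ≤ Fintype.card V + 2 * crossing G H := by
  obtain ⟨I, hI, hP⟩ := exists_sum_degree_eq_potential G H
  simp only [transversals, mem_filter, mem_univ, true_and] at hI
  set out : V → Finset V := fun v => univ.filter fun w => G.Adj v w ∧ ¬ H.Reachable v w with hout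
  have h1 : ∀ v, G.degree v ≤ #(univ.filter fun w => H.Reachable v w) + #(out v) := by
    intro v
    rw [← card_neighborFinset_eq_degree]
    refine (card_le_card fun w hw => ?_).trans (card_union_le _ _)
    rw [mem_neighborFinset] at hw
    simp only [hout, mem_union, mem_filter, mem_univ, true_and]
    tauto
  have h2 : ∑ v ∈ I, #(univ.filter fun w => H.Reachable v w) ≤ Fintype.card V := by
    rw [← card_biUnion]
    · exact card_le_univ _
    · intro x hx y hy hxy
      refine Finset.disjoint_left.2 ?_
      intro w hw hw'
      simp only [mem_filter, mem_univ, true_and] at hw hw'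
      exact hxy (hI x hx y hy (hw.trans hw'.symm))
  have h3 : ∑ v, #(out v) ≤ 2 * crossing G H := by
    have h4 : ∀ v, #(out v) ≤ #(crossingNeighbors G H v) +
        #(univ.filter fun w => v ∈ crossingNeighbors G H w) := by
      intro v
      refine (card_le_card fun w hw => ?_).trans (card_union_le _ _)
      simp only [hout, mem_filter, mem_univ, true_and] at hw
      simp only [crossingNeighbors, mem_union, mem_filter, mem_univ, true_and]
      rcases le_total (G.degree v) (G.degree w) with h | h
      · exact Or.inl ⟨hw.1, hw.2, h⟩
      · exact Or.inr ⟨hw.1.symm, fun hr => hw.2 hr.symm, h⟩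
    have h5 : ∑ v, #(univ.filter fun w => v ∈ crossingNeighbors G H w) = crossing G H := by
      unfold crossing
      simp only [card_filter]
      rw [sum_comm]
      refine sum_congr rfl fun w _ => ?_
      rw [← card_filter, filter_mem_eq_inter, univ_inter]
    calc ∑ v, #(out v) ≤ ∑ v, (#(crossingNeighbors G H v) +
          #(univ.filter fun w => v ∈ crossingNeighbors G H w)) := sum_le_sum fun v _ => h4 v
      _ = 2 * crossing G H := by rw [sum_add_distrib, h5]; unfold crossing; ring
  calc potential G H = ∑ v ∈ I, G.degree v := hP
    _ ≤ ∑ v ∈ I, (#(univ.filter fun w => H.Reachable v w) + #(out v)) :=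
        sum_le_sum fun v _ => h1 v
    _ = _ := sum_add_distrib
    _ ≤ Fintype.card V + 2 * crossing G H :=
        add_le_add h2 ((sum_le_univ_sum_of_nonneg fun _ => Nat.zero_le _).trans h3)

/-- The amount by which the potential exceeds the number of vertices. -/
noncomputable def excess (G H : SimpleGraph V) : ℝ := potential G H - Fintype.card V

theorem excess_antitone (G : SimpleGraph V) : Antitone (excess G) :=
  fun _ _ h => sub_le_sub_right (by exact_mod_cast potential_antitone G h) _

theorem excess_le_two_mul_crossing (G H : SimpleGraph V) : excess G H ≤ 2 * crossing G H := by
  rw [excess, sub_le_iff_le_add']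
  exact_mod_cast potential_le_card_add_crossing G H

theorem ncard_interComponentEdges_le (G H : SimpleGraph V) :
    (interComponentEdges G H).ncard ≤ crossing G H := by
  classical
  have h : interComponentEdges G H ⊆
      ((univ.biUnion fun u => (crossingNeighbors G H u).image fun w => s(u, w) :
        Finset (Sym2 V)) : Set (Sym2 V)) := by
    rintro e ⟨he, u, v, rfl, huv⟩
    have hr : ¬ H.Reachable u v := fun h => huv (ConnectedComponent.eq.2 h)
    rw [mem_edgeSet] at he
    simp only [coe_biUnion, Set.mem_iUnion, coe_image, Set.mem_image, mem_coe, mem_univ,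
      crossingNeighbors, mem_filter, true_and]
    rcases le_total (G.degree u) (G.degree v) with hd | hd
    · exact ⟨u, trivial, v, ⟨he, hr, hd⟩, rfl⟩
    · exact ⟨v, trivial, u, ⟨he.symm, fun h => hr h.symm, hd⟩, Sym2.eq_swap⟩
  refine (Set.ncard_le_ncard h (finite_toSet _)).trans ?_
  rw [Set.ncard_coe_finset]
  exact card_biUnion_le.trans (sum_le_sum fun u _ => card_image_le)

/-! ### One sweep of single picks -/

theorem exp_neg_le_one_sub_half {x : ℝ} (h0 : 0 ≤ x) (h1 : x ≤ 1) :
    Real.exp (-x) ≤ 1 - x / 2 := by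
  rw [Real.exp_neg, inv_le_comm₀ (Real.exp_pos x) (by linarith)]
  refine le_trans ?_ (Real.add_one_le_exp x)
  rw [inv_le_iff_one_le_mul₀ (by linarith)]
  nlinarith

open Classical in
/-- The choice of a single edge at a vertex of positive degree is the choice of a neighbour. -/
theorem avg_choices_one (G : SimpleGraph V) (u : V) (hu : 0 < G.degree u)
    (f : SimpleGraph V → ℝ) (H : SimpleGraph V) :
    avg (choices G 1 u) f H =
      𝔼 w ∈ G.neighborFinset u, f (H ⊔ fromEdgeSet {s(u, w)}) := by
  have h : choices G 1 u = (G.neighborFinset u).image fun w => {s(u, w)} := by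
    ext T
    simp only [choices, min_eq_left (Nat.succ_le_of_lt hu), mem_powersetCard, card_eq_one,
      mem_image, mem_neighborFinset]
    constructor
    · rintro ⟨hT, e, rfl⟩
      rw [singleton_subset_iff, mem_incidenceFinset] at hT
      obtain ⟨he, hue⟩ := hT
      obtain ⟨w, rfl⟩ := Sym2.mem_iff_exists.1 hue
      exact ⟨w, he, rfl⟩
    · rintro ⟨w, hw, rfl⟩
      exact ⟨by simpa [mem_incidenceFinset, incidenceSet] using hw, _, rfl⟩
  have hinj : Set.InjOn (fun w => ({s(u, w)} : Finset (Sym2 V))) (G.neighborFinset u) := by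
    intro a _ b _ hab
    exact Sym2.congr_right.1 (singleton_injective hab)
  rw [avg, h, expect_eq_sum_div_card, expect_eq_sum_div_card, sum_image hinj,
    card_image_of_injOn hinj]
  simp

open Classical in
/-- A single pick of `u` merges two components with probability at least `a / deg u`, where `a`
is the number of crossing edges counted at `u`, and then lowers the potential by at least `deg u`.
The expected decrease is therefore at least `a`, whatever the degree; this is its exponential
form. -/
theorem avg_exp_excess_le (G : SimpleGraph V) (u : V) {s : ℝ} (hs : 0 ≤ s)
    (hs' : s * Fintype.card V ≤ 1) (H : SimpleGraph V) :
    avg (choices G 1 u) (fun K => Real.exp (s * excess G K)) H ≤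
      Real.exp (s * excess G H - s / 2 * #(crossingNeighbors G H u)) := by
  have hsub : crossingNeighbors G H u ⊆ G.neighborFinset u := fun w hw => by
    simp only [crossingNeighbors, mem_filter, mem_univ, true_and] at hw
    exact (mem_neighborFinset _ _ _).2 hw.1
  rcases Nat.eq_zero_or_pos (G.degree u) with hd | hd
  · have hc : #(crossingNeighbors G H u) = 0 := by
      have := card_le_card hsub
      rw [card_neighborFinset_eq_degree] at this
      omega
    rw [hc]
    refine expect_le (choices_nonempty G 1 u) fun S _ => ?_
    rw [Nat.cast_zero, mul_zero, sub_zero]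
    exact Real.exp_le_exp.2 (mul_le_mul_of_nonneg_left
      (excess_antitone G le_sup_left) hs)
  · rw [avg_choices_one G u hd]
    set a := #(crossingNeighbors G H u) with ha
    set d := G.degree u with hdd
    have hdR : (0 : ℝ) < d := by exact_mod_cast hd
    have hsd : s * d ≤ 1 := by
      refine le_trans (mul_le_mul_of_nonneg_left ?_ hs) hs'
      exact_mod_cast (G.degree_lt_card_verts u).le
    set P := Real.exp (s * excess G H) with hP
    have hP0 : 0 < P := Real.exp_pos _
    have hle : ∀ w ∈ G.neighborFinset u,
        Real.exp (s * excess G (H ⊔ fromEdgeSet {s(u, w)})) ≤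
          P - if w ∈ crossingNeighbors G H u then P * (s * d / 2) else 0 := by
      intro w hw
      rw [mem_neighborFinset] at hw
      split_ifs with hwc
      · simp only [crossingNeighbors, mem_filter, mem_univ, true_and] at hwc
        have hadj : (H ⊔ fromEdgeSet {s(u, w)}).Adj u w := by simp [hw.ne]
        have hdrop := degree_add_potential_le G (H' := H ⊔ fromEdgeSet {s(u, w)}) le_sup_left
          hwc.2.1 hadj.reachable hwc.2.2
        have hdrop' : (d : ℝ) + potential G (H ⊔ fromEdgeSet {s(u, w)}) ≤ potential G H := by
          exact_mod_cast hdrop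
        calc Real.exp (s * excess G (H ⊔ fromEdgeSet {s(u, w)}))
            ≤ Real.exp (s * excess G H + -(s * d)) := by
              rw [Real.exp_le_exp, excess, excess]
              nlinarith
          _ = P * Real.exp (-(s * d)) := Real.exp_add _ _
          _ ≤ P * (1 - s * d / 2) :=
              mul_le_mul_of_nonneg_left (exp_neg_le_one_sub_half (by positivity) hsd) hP0.le
          _ = _ := by ring
      · rw [sub_zero]
        exact Real.exp_le_exp.2 (mul_le_mul_of_nonneg_left
          (excess_antitone G le_sup_left) hs)
    calc 𝔼 w ∈ G.neighborFinset u, Real.exp (s * excess G (H ⊔ fromEdgeSet {s(u, w)}))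
        ≤ 𝔼 w ∈ G.neighborFinset u,
            (P - if w ∈ crossingNeighbors G H u then P * (s * d / 2) else 0) :=
          expect_le_expect hle
      _ = P * (1 - s / 2 * a) := by
          rw [expect_eq_sum_div_card, sum_sub_distrib, sum_const, card_neighborFinset_eq_degree,
            ← sum_filter, filter_mem_eq_inter, inter_eq_right.2 hsub, sum_const, ← ha, ← hdd,
            nsmul_eq_mul, nsmul_eq_mul]
          field_simp
      _ ≤ P * Real.exp (-(s / 2 * a)) := by
          refine mul_le_mul_of_nonneg_left ?_ hP0.le
          linarith [Real.add_one_le_exp (-(s / 2 * (a : ℝ)))]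
      _ = _ := by rw [hP, ← Real.exp_add]; ring_nf

theorem antitone_exp_mul_natCast {α : Type*} [Preorder α] {g : α → ℕ} (hg : Antitone g) {s : ℝ}
    (hs : 0 ≤ s) : Antitone fun K => Real.exp (s * g K) :=
  fun _ _ h => Real.exp_le_exp.2 (mul_le_mul_of_nonneg_left (by exact_mod_cast hg h) hs)

theorem sweep_exp_excess_add_le (G : SimpleGraph V) {s : ℝ} (hs : 0 ≤ s)
    (hs' : s * Fintype.card V ≤ 1) (L : List V) :
    sweep G 1 L (fun K => Real.exp (s * excess G K +
        s / 2 * ((L.map fun u => #(crossingNeighbors G K u)).sum : ℕ))) ≤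
      fun K => Real.exp (s * excess G K) := by
  induction L with
  | nil => intro K; simp
  | cons u L ih =>
    -- The crossing edges counted at `u` only disappear later on, so their number may be taken
    -- before the pick of `u`.
    set c : SimpleGraph V → ℝ := fun K => Real.exp (s / 2 * #(crossingNeighbors G K u)) with hc
    have hcA : Antitone c :=
      antitone_exp_mul_natCast (crossingNeighbors_antitone G u) (by positivity)
    have hsplit : (fun K => Real.exp (s * excess G K +
        s / 2 * (((u :: L).map fun u => #(crossingNeighbors G K u)).sum : ℕ))) =
        c * fun K => Real.exp (s * excess G K +
          s / 2 * ((L.map fun u => #(crossingNeighbors G K u)).sum : ℕ)) := by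
      ext K
      rw [Pi.mul_apply, hc, ← Real.exp_add, List.map_cons, List.sum_cons]
      push_cast
      ring_nf
    rw [hsplit]
    refine (sweep_mul_le G 1 (u :: L) (fun K => (Real.exp_pos _).le) hcA).trans fun K => ?_
    rw [Pi.mul_apply, sweep_cons]
    calc c K * avg (choices G 1 u) (sweep G 1 L _) K
        ≤ c K * avg (choices G 1 u) (fun K => Real.exp (s * excess G K)) K :=
          mul_le_mul_of_nonneg_left (avg_mono _ ih K) (Real.exp_pos _).le
      _ ≤ c K * Real.exp (s * excess G K - s / 2 * #(crossingNeighbors G K u)) :=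
          mul_le_mul_of_nonneg_left (avg_exp_excess_le G u hs hs' K) (Real.exp_pos _).le
      _ = _ := by rw [hc, ← Real.exp_add]; ring_nf

/-- In a sweep over all vertices, the potential and the number of crossing edges that survive are
paid for by the initial potential. -/
theorem sweep_exp_excess_add_crossing_le (G : SimpleGraph V) {s : ℝ} (hs : 0 ≤ s)
    (hs' : s * Fintype.card V ≤ 1) :
    sweep G 1 univ.toList (fun K => Real.exp (s * excess G K + s / 2 * crossing G K)) ≤
      fun K => Real.exp (s * excess G K) := by
  simpa only [Finset.sum_map_toList, crossing] using sweep_exp_excess_add_le G hs hs' univ.toList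

/-! ### Iterating the sweeps -/

/-- The excess is at most twice the number of crossing edges, so that each sweep consumes a
constant fraction of it. -/
theorem sweep_exp_excess_le (G : SimpleGraph V) {s : ℝ} (hs : 0 ≤ s)
    (hs' : s * Fintype.card V ≤ 1) :
    sweep G 1 univ.toList (fun K => Real.exp (s * excess G K)) ≤
      fun K => Real.exp (4 / 5 * s * excess G K) := by
  refine (sweep_mono G 1 _ fun K => ?_).trans
    (sweep_exp_excess_add_crossing_le G (s := 4 / 5 * s) (by positivity) (by linarith))
  rw [Real.exp_le_exp]
  nlinarith [excess_le_two_mul_crossing G K]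

theorem iterate_sweep_mono (G : SimpleGraph V) (L : List V) (m : ℕ) :
    Monotone (sweep G 1 L)^[m] :=
  Monotone.iterate (fun _ _ h => sweep_mono G 1 L h) m

theorem iterate_sweep_exp_excess_le (G : SimpleGraph V) (T : ℕ) {s : ℝ} (hs : 0 ≤ s)
    (hs' : s * Fintype.card V ≤ 1) :
    (sweep G 1 univ.toList)^[T] (fun K => Real.exp (s * excess G K)) ≤
      fun K => Real.exp ((4 / 5) ^ T * s * excess G K) := by
  induction T generalizing s with
  | zero => intro K; simp
  | succ T ih =>
    rw [Function.iterate_succ_apply]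
    refine (iterate_sweep_mono G _ T (sweep_exp_excess_le G hs hs')).trans ?_
    refine (ih (s := 4 / 5 * s) (by positivity) (by linarith)).trans_eq ?_
    ext K
    ring_nf

/-- Each crossing edge that survives `m` sweeps is counted in every one of them. -/
theorem iterate_sweep_exp_crossing_le (G : SimpleGraph V) (m : ℕ) {s : ℝ} (hs : 0 ≤ s)
    (hs' : s * Fintype.card V ≤ 1) :
    (sweep G 1 univ.toList)^[m]
        (fun K => Real.exp (s * excess G K + s / 2 * m * crossing G K)) ≤
      fun K => Real.exp (s * excess G K) := by
  induction m with
  | zero => intro K; simp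
  | succ m ih =>
    rw [Function.iterate_succ_apply]
    refine (iterate_sweep_mono G _ m ?_).trans ih
    set c : SimpleGraph V → ℝ := fun K => Real.exp (s / 2 * m * crossing G K) with hc
    have hcA : Antitone c := antitone_exp_mul_natCast (crossing_antitone G) (by positivity)
    have hsplit : (fun K => Real.exp (s * excess G K + s / 2 * (m + 1 : ℕ) * crossing G K)) =
        c * fun K => Real.exp (s * excess G K + s / 2 * crossing G K) := by
      ext K
      rw [Pi.mul_apply, hc, ← Real.exp_add]
      push_cast
      ring_nf
    rw [hsplit]
    refine (sweep_mul_le G 1 _ (fun K => (Real.exp_pos _).le) hcA).trans fun K => ?_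
    rw [Pi.mul_apply]
    refine (mul_le_mul_of_nonneg_left (sweep_exp_excess_add_crossing_le G hs hs' K)
      (Real.exp_pos _).le).trans_eq ?_
    rw [← Real.exp_add]
    ring_nf

/-! ### The exponential moment and the tail bound -/

theorem pow_half_mul_card_le {n k : ℕ} (hn : 0 < n) (hk : 10 * Real.log n ≤ k) :
    (4 / 5 : ℝ) ^ (k / 2) * n ≤ 2 := by
  have hT : (k : ℝ) ≤ 2 * (k / 2 : ℕ) + 1 := by
    have : k ≤ 2 * (k / 2) + 1 := by omega
    exact_mod_cast this
  have hr : (4 / 5 : ℝ) ≤ Real.exp (-(1 / 5)) := by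
    linarith [Real.add_one_le_exp (-(1 / 5) : ℝ)]
  have h2 : Real.exp (1 / 10) ≤ 2 := by
    have h9 : (2 : ℝ)⁻¹ ≤ Real.exp (-(1 / 10)) := by
      linarith [Real.add_one_le_exp (-(1 / 10) : ℝ)]
    rw [Real.exp_neg] at h9
    exact (inv_le_inv₀ two_pos (Real.exp_pos _)).1 h9
  calc (4 / 5 : ℝ) ^ (k / 2) * n ≤ Real.exp (-(1 / 5)) ^ (k / 2) * Real.exp (Real.log n) := by
        rw [Real.exp_log (by exact_mod_cast hn)]
        gcongr
    _ = Real.exp ((k / 2 : ℕ) * -(1 / 5) + Real.log n) := by rw [← Real.exp_nat_mul, Real.exp_add]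
    _ ≤ Real.exp (1 / 10) := Real.exp_le_exp.2 (by linarith)
    _ ≤ 2 := h2

open Classical in
theorem expect_exp_crossing_le (G : SimpleGraph V) {k : ℕ} (hn : 0 < Fintype.card V)
    (hk : 10 * Real.log (Fintype.card V) ≤ k) :
    𝔼 S ∈ Fintype.piFinset (choices G k),
      Real.exp (k / (4 * Fintype.card V) * crossing G (chosenSubgraph S)) ≤ Real.exp 3 := by
  set n : ℝ := (Fintype.card V : ℝ) with hnn
  have hn0 : 0 < n := by rw [hnn]; exact_mod_cast hn
  have hs : 0 ≤ 1 / n := by positivity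
  have hs' : 1 / n * Fintype.card V ≤ 1 := by rw [← hnn, one_div_mul_cancel hn0.ne']
  set f : SimpleGraph V → ℝ := fun K => Real.exp (k / (4 * n) * crossing G K) with hf
  have hfA : Antitone f := antitone_exp_mul_natCast (crossing_antitone G) (by positivity)
  have hkm : k / 2 + (k - k / 2) = k := by omega
  have hm : (k : ℝ) ≤ 2 * (k - k / 2 : ℕ) := by
    have : k ≤ 2 * (k - k / 2) := by omega
    exact_mod_cast this
  -- The potential is nonnegative, so the excess is at least `-n`.
  have hfle : (fun K => Real.exp (-1) * f K) ≤ fun K =>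
      Real.exp (1 / n * excess G K + 1 / n / 2 * (k - k / 2 : ℕ) * crossing G K) := by
    intro K
    simp only [hf]
    rw [← Real.exp_add, Real.exp_le_exp]
    have h1 : -1 ≤ 1 / n * excess G K := by
      have h : -n ≤ excess G K := by
        rw [excess, ← hnn]
        linarith [Nat.cast_nonneg (α := ℝ) (potential G K)]
      calc (-1 : ℝ) = 1 / n * -n := by field_simp
        _ ≤ _ := mul_le_mul_of_nonneg_left h hs
    refine add_le_add h1 (mul_le_mul_of_nonneg_right ?_ (Nat.cast_nonneg _))
    calc (k : ℝ) / (4 * n) = 1 / n / 4 * k := by ring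
      _ ≤ 1 / n / 4 * (2 * (k - k / 2 : ℕ)) := mul_le_mul_of_nonneg_left hm (by positivity)
      _ = _ := by ring
  have hiter : (sweep G 1 univ.toList)^[k] (fun K => Real.exp (-1) * f K) ≤
      fun K => Real.exp ((4 / 5) ^ (k / 2) * (1 / n) * excess G K) := by
    conv_lhs => rw [← hkm]
    rw [Function.iterate_add_apply]
    refine (iterate_sweep_mono G _ _ ((iterate_sweep_mono G _ _ hfle).trans
      (iterate_sweep_exp_crossing_le G _ hs hs'))).trans ?_
    exact iterate_sweep_exp_excess_le G _ hs hs'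
  have hbot : (4 / 5 : ℝ) ^ (k / 2) * (1 / n) * excess G ⊥ ≤ 2 := by
    have h : excess G ⊥ ≤ n * n := by
      have : (potential G ⊥ : ℝ) ≤ n * n := by rw [hnn]; exact_mod_cast potential_le G ⊥
      rw [excess, ← hnn]
      linarith
    calc (4 / 5 : ℝ) ^ (k / 2) * (1 / n) * excess G ⊥
        ≤ (4 / 5 : ℝ) ^ (k / 2) * (1 / n) * (n * n) :=
          mul_le_mul_of_nonneg_left h (by positivity)
      _ = (4 / 5 : ℝ) ^ (k / 2) * n := by field_simp
      _ ≤ 2 := pow_half_mul_card_le hn hk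
  have hE := expect_choices_eq_sweep G k univ.toList (nodup_toList _)
    (fun K => Real.exp (-1) * f K) ⊥
  simp only [mem_toList, mem_univ, true_and, bot_sup_eq] at hE
  rw [← mul_expect] at hE
  have hfA' : Antitone fun K => Real.exp (-1) * f K := hfA.const_mul (Real.exp_pos _).le
  have h := hE.trans_le ((sweep_le_iterate G univ.toList k hfA' ⊥).trans
    ((hiter ⊥).trans (Real.exp_le_exp.2 hbot)))
  rw [Real.exp_neg, inv_mul_le_iff₀ (Real.exp_pos _), ← Real.exp_add] at h
  exact h.trans_eq (by norm_num)

theorem exp_three_sub_le {ℓ : ℝ} (hℓ : 1 ≤ ℓ) : Real.exp (3 - 4 * ℓ) ≤ 2 ^ (-ℓ) := by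
  rw [Real.rpow_def_of_pos two_pos, Real.exp_le_exp]
  nlinarith [Real.log_two_lt_d9]

end

end KOut

theorem mainTheorem5 :
    ∃ c : ℝ, 0 < c ∧ ∃ b : ℝ, 0 < b ∧
      ∀ (V : Type*) [Fintype V] (G : SimpleGraph V) (k : ℕ), 0 < k →
        c * Real.log (Fintype.card V) ≤ k →
        ∀ ℓ : ℝ, 1 ≤ ℓ →
          (KOut.randomSubgraph G k).toOuterMeasure
              {G' | ℓ * (b * (Fintype.card V : ℝ) / (k : ℝ)) <
                ((KOut.interComponentEdges G G').ncard : ℝ)}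
            ≤ ENNReal.ofReal ((2 : ℝ) ^ (-ℓ)) := by
  classical
  -- The constant 10 makes `k / 2` sweeps exhaust the excess of the potential. With 16, Markov's
  -- inequality gives `exp (3 - 4 * ℓ)`, where the 3 comes from the bound on the exponential moment.
  refine ⟨10, by norm_num, 16, by norm_num, ?_⟩
  intro V _ G k hk0 hk ℓ hℓ
  have hkR : (0 : ℝ) < k := by exact_mod_cast hk0
  rw [KOut.randomSubgraph, PMF.toOuterMeasure_map_apply, KOut.choiceLaw,
    PMF.toOuterMeasure_uniformOfFinset_apply]
  set Ω := Fintype.piFinset (KOut.choices G k) with hΩ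
  set B := Ω.filter fun S => S ∈ KOut.chosenSubgraph ⁻¹' {G' |
    ℓ * (16 * (Fintype.card V : ℝ) / (k : ℝ)) <
      ((KOut.interComponentEdges G G').ncard : ℝ)} with hB
  have hΩ0 : (0 : ℝ) < Ω.card := by
    exact_mod_cast Finset.card_pos.2 (KOut.piChoices_nonempty G k)
  have hmem : ∀ S ∈ B, ℓ * (16 * (Fintype.card V : ℝ) / (k : ℝ)) <
      (KOut.crossing G (KOut.chosenSubgraph S) : ℝ) := fun S hS =>
    lt_of_lt_of_le (Finset.mem_filter.1 hS).2
      (by exact_mod_cast KOut.ncard_interComponentEdges_le G _)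
  have hreal : (B.card : ℝ) / Ω.card ≤ 2 ^ (-ℓ) := by
    rcases Nat.eq_zero_or_pos (Fintype.card V) with hn | hn
    · have hB0 : B = ∅ := by
        refine Finset.eq_empty_of_forall_notMem fun S hS => ?_
        have : IsEmpty V := Fintype.card_eq_zero_iff.1 hn
        have := hmem S hS
        simp [KOut.crossing] at this
      rw [hB0]
      simpa using Real.rpow_nonneg two_pos.le (-ℓ)
    · have hnR : (0 : ℝ) < Fintype.card V := by exact_mod_cast hn
      have hE := KOut.expect_exp_crossing_le G hn hk
      rw [← hΩ, Finset.expect_eq_sum_div_card, div_le_iff₀ hΩ0] at hE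
      have hlow : (B.card : ℝ) * Real.exp (4 * ℓ) ≤ Real.exp 3 * Ω.card := by
        refine le_trans ?_ hE
        rw [← nsmul_eq_mul]
        refine (Finset.card_nsmul_le_sum B _ _ fun S hS => ?_).trans
          (Finset.sum_le_sum_of_subset_of_nonneg (Finset.filter_subset _ _)
            fun _ _ _ => (Real.exp_pos _).le)
        rw [Real.exp_le_exp]
        calc 4 * ℓ = k / (4 * Fintype.card V) *
              (ℓ * (16 * (Fintype.card V : ℝ) / (k : ℝ))) := by
              field_simp
              norm_num
          _ ≤ _ := mul_le_mul_of_nonneg_left (hmem S hS).le (by positivity)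
      refine le_trans ?_ (KOut.exp_three_sub_le hℓ)
      rw [div_le_iff₀ hΩ0, Real.exp_sub, div_mul_eq_mul_div, le_div_iff₀ (Real.exp_pos _)]
      exact hlow
  rw [← ENNReal.ofReal_natCast B.card, ← ENNReal.ofReal_natCast Ω.card,
    ← ENNReal.ofReal_div_of_pos hΩ0]
  exact ENNReal.ofReal_le_ofReal hreal
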